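/- Consider the following part of an $n$-round prepare-and-measure QKD protocol ($n\in\mathbb N_0$). All logarithms are in base $2$. Let $\mathcal V,\mathcal I,\mathcal S$ be finite alphabets, $\mathcal U$ an alphabet, $Q$ a quantum system with (arbitrary) Hilbert space $\mathcal H_Q$, $\psi_{UQ}=\sum_{u\in\mathcal U}p(u)\,|u\rangle\langle u|\otimes\psi_{Q|u}$ a cq-state, $\{N^{(v)}\}_{v\in\mathcal V}$ a POVM on $\mathcal H_Q$, and $\textsc{pd}:\mathcal U\times\mathcal V\to\mathcal I$, $\textsc{rk}:\mathcal U\times\mathcal I\to\mathcal S$ functions. Let the noise model be a quantum channel (completely positive trace-preserving map) $\mathcal N:Q\to Q$. In each round of the honest implementation Alice prepares $\psi_{UQ}$ and sends $Q$ through $\mathcal N$ to Bob, who measures $\{N^{(v)}\}$ and obtains $V$; then $I=\textsc{pd}(U,V)$ is published and Alice sets $S=\textsc{rk}(U,I)$. Let $\nu^{\mathrm{hon}}$ be the resulting single-round state of $U,V,I,S$, and $H(S|VI)_{\nu^{\mathrm{hon}}}$ its conditional von Neumann entropy. The $n$ rounds are independent and identically distributed. In the error-correction step, with a one-way protocol,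 Alice sends a bit string $\mathrm{enc}(S^n)\in\{0,1\}^{\lambda_{\mathrm{ec}}}$ and Bob computes a guess $\hat S^n=\mathrm{dec}(\mathrm{enc}(S^n),V^n,I^n)\in\mathcal S^n$. In the raw-key validation step, a function $\textsc{Hash}:\mathcal S^n\to\{0,1\}^{\lceil\log(1/\varepsilon_{\mathrm{kv}})\rceil}$ (output length $0$ if $\varepsilon_{\mathrm{kv}}\ge 1$) is drawn, independently of the data, from a universal hash family (a distribution on functions $\mathcal S^n\to\{0,1\}^{l}$ with $\Pr[f(x)=f(x')]\le 2^{-l}$ for all $x\ne x'$), and the protocol aborts if $\textsc{Hash}(S^n)\neq\textsc{Hash}(\hat S^n)$. **Lemma.** Fix a noise model $\mathcal N$ and protocol arguments as above, including $n$ and $\lambda_{\mathrm{ec}}\in\mathbb N_0$, and let $\varepsilon^{\mathrm{comp}}_{\mathrm{kv}}\in(0,1]$. If $$\lambda_{\mathrm{ec}}\ \ge\ n\,H(S|VI)_{\nu^{\mathrm{hon}}}+2\sqrt n\,\sqrt{1-2\log(\varepsilon^{\mathrm{comp}}_{\mathrm{kv}}/2)}\;\log(1+2|\mathcal S|)+2\log\frac{2}{\varepsilon^{\mathrm{comp}}_{\mathrm{kv}}},$$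 then there is a one-way error-correction protocol $(\mathrm{enc},\mathrm{dec})$ with message length $\lambda_{\mathrm{ec}}$ for which, in the honest implementation, $\Pr[S^n\neq\hat S^n]\le\varepsilon^{\mathrm{comp}}_{\mathrm{kv}}$. Consequently, for every $\varepsilon_{\mathrm{kv}}>0$ and every universal hash family as above, raw-key validation aborts with probability at most $\varepsilon^{\mathrm{comp}}_{\mathrm{kv}}$. -/

import Mathlib

open scoped ENNReal ComplexOrder InnerProductSpace

noncomputable section

namespace QKD

/-! ### States, channels and measurements on a Hilbert space of arbitrary dimension -/

section Hilbert

variable (H : Type*) [NormedAddCommGroup H] [InnerProductSpace ℂ H] [CompleteSpace H]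

/-- Index set of a fixed orthonormal basis of the Hilbert space. -/
def BasisIndex : Set H := (exists_hilbertBasis ℂ H).choose

/-- A fixed orthonormal (Hilbert) basis. -/
def onb : HilbertBasis (BasisIndex H) ℂ H := (exists_hilbertBasis ℂ H).choose_spec.choose

variable {H}

/-- The trace `∑ᵢ ⟨eᵢ, T eᵢ⟩`; only used for trace-class operators, where the sum converges
absolutely and does not depend on the basis. -/
def trace (T : H →L[ℂ] H) : ℂ := ∑' i, ⟪onb H i, T (onb H i)⟫_ℂ

/-- A positive operator of finite trace. -/
def IsPosTrace (T : H →L[ℂ] H) : Prop :=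
  T.IsPositive ∧ Summable fun i => ⟪onb H i, T (onb H i)⟫_ℂ

variable (H) in
/-- The trace-class operators: the linear span of the positive operators of finite trace. -/
def TraceClass : Submodule ℂ (H →L[ℂ] H) := Submodule.span ℂ {T | IsPosTrace T}

variable (H) in
/-- The set `S(Q)` of states: positive operators of trace one. -/
structure State where
  op : H →L[ℂ] H
  pos : op.IsPositive
  trace_one : HasSum (fun i => ⟪onb H i, op (onb H i)⟫_ℂ) 1

lemma State.isPosTrace (ρ : State H) : IsPosTrace ρ.op := ⟨ρ.pos, ρ.trace_one.summable⟩

/-- A state as a trace-class operator. -/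
def State.toTraceClass (ρ : State H) : TraceClass H :=
  ⟨ρ.op, Submodule.subset_span ρ.isPosTrace⟩

variable (H) in
/-- A quantum channel `Q → Q`: a completely positive, trace-preserving linear map on trace-class
operators. An `m × m` block matrix `(T i j)` of operators is an operator on `ℂᵐ ⊗ H`; it is positive
iff `∑ᵢⱼ ⟨xᵢ, T i j xⱼ⟩ ≥ 0` for all vectors `(xᵢ)`, and `id ⊗ 𝒩` acts on it blockwise. -/
structure Channel where
  map : TraceClass H →ₗ[ℂ] TraceClass H
  trace_preserving : ∀ T : TraceClass H, trace (map T : H →L[ℂ] H) = trace (T : H →L[ℂ] H)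
  completely_positive : ∀ (m : ℕ) (T : Fin m → Fin m → TraceClass H),
    (∀ x : Fin m → H, 0 ≤ ∑ i, ∑ j, ⟪x i, (T i j : H →L[ℂ] H) (x j)⟫_ℂ) →
    ∀ x : Fin m → H, 0 ≤ ∑ i, ∑ j, ⟪x i, (map (T i j) : H →L[ℂ] H) (x j)⟫_ℂ

lemma summable_of_mem_traceClass {T : H →L[ℂ] H} (hT : T ∈ TraceClass H) :
    Summable fun i => ⟪onb H i, T (onb H i)⟫_ℂ := by
  induction hT using Submodule.span_induction with
  | mem x hx => exact hx.2
  | zero => simp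
  | add x y _ _ hx hy => simpa [inner_add_right] using hx.add hy
  | smul a x _ hx => simpa [inner_smul_right] using hx.mul_left a

/-- The state obtained by sending a state through a channel. -/
def Channel.apply (N : Channel H) (ρ : State H) : State H where
  op := N.map ρ.toTraceClass
  pos := by
    rw [ContinuousLinearMap.isPositive_iff']
    have key : ∀ x : H, 0 ≤ ⟪x, (N.map ρ.toTraceClass : H →L[ℂ] H) x⟫_ℂ := by
      intro x
      have := N.completely_positive 1 (fun _ _ => ρ.toTraceClass)
        (fun x => by
          simp only [Fin.sum_univ_one]
          exact ρ.pos.inner_nonneg_right (x 0)) (fun _ => x)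
      simpa using this
    have key2 : (N.map ρ.toTraceClass : H →L[ℂ] H).IsPositive := by
      rw [ContinuousLinearMap.isPositive_iff_complex]
      intro x
      have h2 := Complex.le_def.1 (key x)
      rw [Complex.zero_re, Complex.zero_im] at h2
      rw [← inner_conj_symm]
      refine ⟨?_, by rw [RCLike.conj_re]; exact h2.1⟩
      rw [RCLike.conj_re]
      apply Complex.ext
      · rfl
      · rw [Complex.conj_im, ← h2.2, neg_zero]
        rfl
    exact (ContinuousLinearMap.isPositive_iff' _).1 key2
  trace_one := by
    have h := (summable_of_mem_traceClass (N.map ρ.toTraceClass).2).hasSum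
    have h2 := N.trace_preserving ρ.toTraceClass
    have h3 : trace (ρ.toTraceClass : H →L[ℂ] H) = 1 := ρ.trace_one.tsum_eq
    rw [h3] at h2
    unfold trace at h2
    rwa [h2] at h

/-- Hilbert-Schmidt property, in the fixed basis. -/
def IsHS (A : H →L[ℂ] H) : Prop := Summable fun i => ‖A (onb H i)‖ ^ 2

lemma hasSum_parseval (x : H) : HasSum (fun i => ‖⟪onb H i, x⟫_ℂ‖ ^ 2) (‖x‖ ^ 2) := by
  have h := (onb H).hasSum_inner_mul_inner x x
  have h2 := Complex.hasSum_re h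
  have e1 : (⟪x, x⟫_ℂ).re = ‖x‖ ^ 2 := inner_self_eq_norm_sq (𝕜 := ℂ) x
  rw [e1] at h2
  convert h2 using 2 with i
  rw [← inner_conj_symm x, ← Complex.normSq_eq_conj_mul_self, Complex.ofReal_re,
    Complex.normSq_eq_norm_sq]

lemma IsHS.summable_prod {A : H →L[ℂ] H} (hA : IsHS A) :
    Summable fun q : BasisIndex H × BasisIndex H => ‖⟪onb H q.2, A (onb H q.1)⟫_ℂ‖ ^ 2 := by
  have h0 : ∀ q : BasisIndex H × BasisIndex H, 0 ≤ ‖⟪onb H q.2, A (onb H q.1)⟫_ℂ‖ ^ 2 :=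
    fun _ => sq_nonneg _
  refine (summable_prod_of_nonneg h0).2 ⟨fun i => (hasSum_parseval (A (onb H i))).summable, ?_⟩
  exact Summable.congr hA fun i => (hasSum_parseval (A (onb H i))).tsum_eq.symm

lemma IsHS.summable_mul {A B : H →L[ℂ] H} (hA : IsHS A) (hB : IsHS B) :
    Summable fun q : BasisIndex H × BasisIndex H =>
      ⟪onb H q.1, A (onb H q.2)⟫_ℂ * ⟪onb H q.2, B (onb H q.1)⟫_ℂ := by
  refine Summable.of_norm_bounded
    ((hA.summable_prod.comp_injective Prod.swap_injective).add hB.summable_prod) ?_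
  intro q
  rw [norm_mul]
  simp only [Function.comp, Prod.fst_swap, Prod.snd_swap]
  nlinarith [sq_nonneg (‖⟪onb H q.1, A (onb H q.2)⟫_ℂ‖ - ‖⟪onb H q.2, B (onb H q.1)⟫_ℂ‖),
    sq_nonneg (‖⟪onb H q.1, A (onb H q.2)⟫_ℂ‖ + ‖⟪onb H q.2, B (onb H q.1)⟫_ℂ‖)]

lemma hasSum_inner_comp (A B : H →L[ℂ] H) (x : H) :
    HasSum (fun j => ⟪x, A (onb H j)⟫_ℂ * ⟪onb H j, B x⟫_ℂ) ⟪x, A (B x)⟫_ℂ := by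
  have h := (onb H).hasSum_inner_mul_inner (A.adjoint x) (B x)
  simpa [ContinuousLinearMap.adjoint_inner_left] using h

/-- Cyclicity of the trace for a product of two Hilbert-Schmidt operators. -/
lemma IsHS.trace_comm {A B : H →L[ℂ] H} (hA : IsHS A) (hB : IsHS B) :
    (Summable fun i => ⟪onb H i, A (B (onb H i))⟫_ℂ) ∧
    trace (A ∘L B) = trace (B ∘L A) := by
  have h := hA.summable_mul hB
  have h' := hB.summable_mul hA
  constructor
  · have := h.prod
    simpa only [(hasSum_inner_comp A B _).tsum_eq] using this
  · unfold trace
    simp only [ContinuousLinearMap.comp_apply]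
    simp_rw [← (hasSum_inner_comp A B _).tsum_eq, ← (hasSum_inner_comp B A _).tsum_eq]
    have e : ∀ i j, ⟪onb H i, B (onb H j)⟫_ℂ * ⟪onb H j, A (onb H i)⟫_ℂ
        = ⟪onb H j, A (onb H i)⟫_ℂ * ⟪onb H i, B (onb H j)⟫_ℂ := fun _ _ => mul_comm _ _
    simp_rw [e]
    exact (Summable.tsum_comm (f := fun i j =>
      ⟪onb H i, A (onb H j)⟫_ℂ * ⟪onb H j, B (onb H i)⟫_ℂ) h).symm

lemma IsPosTrace.exists_sqrt {T : H →L[ℂ] H} (hT : IsPosTrace T) :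
    ∃ R : H →L[ℂ] H, R.IsPositive ∧ R ∘L R = T ∧ IsHS R := by
  have h0 : 0 ≤ T := (ContinuousLinearMap.nonneg_iff_isPositive T).2 hT.1
  refine ⟨CFC.sqrt T, (ContinuousLinearMap.nonneg_iff_isPositive _).1 (CFC.sqrt_nonneg T),
    CFC.sqrt_mul_sqrt_self T h0, ?_⟩
  have hp : (CFC.sqrt T).IsPositive :=
    (ContinuousLinearMap.nonneg_iff_isPositive _).1 (CFC.sqrt_nonneg T)
  have hs := Complex.hasSum_re hT.2.hasSum
  refine hs.summable.congr ?_
  intro i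
  have e : T (onb H i) = CFC.sqrt T (CFC.sqrt T (onb H i)) := by
    conv_lhs => rw [← CFC.sqrt_mul_sqrt_self T h0]
    rfl
  rw [e, ← hp.inner_left_eq_inner_right]
  exact inner_self_eq_norm_sq (𝕜 := ℂ) (CFC.sqrt T (onb H i))

lemma IsHS.comp_left {B : H →L[ℂ] H} (hB : IsHS B) (A : H →L[ℂ] H) : IsHS (A ∘L B) := by
  refine Summable.of_nonneg_of_le (fun _ => by positivity) (fun i => ?_)
    (Summable.mul_left (‖A‖ ^ 2) hB)
  rw [← mul_pow]
  exact pow_le_pow_left₀ (norm_nonneg _) (A.le_opNorm _) 2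

/-- `tr(E ρ)` converges for every bounded operator `E`. -/
lemma State.summable_born (ρ : State H) (E : H →L[ℂ] H) :
    Summable fun i => ⟪onb H i, E (ρ.op (onb H i))⟫_ℂ := by
  obtain ⟨R, -, hR, hs⟩ := ρ.isPosTrace.exists_sqrt
  have := ((hs.comp_left E).trace_comm hs).1
  rw [← hR]
  simpa using this

/-- `tr(E ρ) ≥ 0` for every positive operator `E`. -/
lemma State.born_nonneg (ρ : State H) {E : H →L[ℂ] H} (hE : E.IsPositive) :
    0 ≤ (trace (E ∘L ρ.op)).re := by
  obtain ⟨R, hRp, hR, hs⟩ := ρ.isPosTrace.exists_sqrt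
  have h := ((hs.comp_left E).trace_comm hs).2
  have h2 := (hs.trace_comm (hs.comp_left E)).1
  rw [← hR, ← ContinuousLinearMap.comp_assoc, h]
  unfold trace
  simp only [ContinuousLinearMap.comp_apply] at h2 ⊢
  rw [Complex.re_tsum h2]
  refine tsum_nonneg fun i => ?_
  rw [← hRp.inner_left_eq_inner_right]
  exact hE.re_inner_nonneg_right _

variable (H) in
/-- A POVM on `H` with finite outcome set `V`. -/
structure POVM (V : Type*) [Fintype V] where
  effect : V → H →L[ℂ] H
  pos : ∀ v, (effect v).IsPositive
  sum_eq_one : ∑ v, effect v = 1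

lemma POVM.sum_born {V : Type*} [Fintype V] (M : POVM H V) (ρ : State H) :
    ∑ v, (trace (M.effect v ∘L ρ.op)).re = 1 := by
  rw [← Complex.re_sum]
  unfold trace
  simp only [ContinuousLinearMap.comp_apply]
  rw [← Summable.tsum_finsetSum (fun v _ => ρ.summable_born (M.effect v))]
  have : ∀ i, ∑ v, ⟪onb H i, M.effect v (ρ.op (onb H i))⟫_ℂ = ⟪onb H i, ρ.op (onb H i)⟫_ℂ := by
    intro i
    rw [← inner_sum, ← sum_apply, M.sum_eq_one]
    rfl
  simp_rw [this]
  rw [ρ.trace_one.tsum_eq]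
  simp

/-- The Born rule: outcome `v` has probability `tr(N⁽ᵛ⁾ ρ)`. -/
def POVM.outcome {V : Type*} [Fintype V] (M : POVM H V) (ρ : State H) : PMF V :=
  PMF.ofFintype (fun v => ENNReal.ofReal (trace (M.effect v ∘L ρ.op)).re) (by
    rw [← ENNReal.ofReal_sum_of_nonneg (fun v _ => ρ.born_nonneg (M.pos v)), M.sum_born]
    simp)

end Hilbert

/-! ### Entropies of finite-dimensional states (logarithms in base two) -/

/-- The von Neumann entropy `-tr(ρ log ρ)`. -/
def vonNeumannEntropy {A : Type*} [Fintype A] [DecidableEq A] (ρ : Matrix A A ℂ) : ℝ :=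
  (Matrix.trace (cfc Real.negMulLog ρ)).re / Real.log 2

/-- The marginal `ρ_B` of `ρ_AB`. -/
def marginalRight {A B : Type*} [Fintype A] (ρ : Matrix (A × B) (A × B) ℂ) : Matrix B B ℂ :=
  Matrix.of fun b b' => ∑ a, ρ (a, b) (a, b')

/-- `H(A|B)_ρ = -tr(ρ_AB log ρ_AB) + tr(ρ_B log ρ_B)`. -/
def condEntropy {A B : Type*} [Fintype A] [DecidableEq A] [Fintype B] [DecidableEq B]
    (ρ : Matrix (A × B) (A × B) ℂ) : ℝ :=
  vonNeumannEntropy ρ - vonNeumannEntropy (marginalRight ρ)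

/-- The classical state `∑ₓ p(x) |x⟩⟨x|`. -/
def classicalState {A : Type*} [DecidableEq A] (p : PMF A) : Matrix A A ℂ :=
  Matrix.diagonal fun x => ((p x).toReal : ℂ)

/-! ### The protocol -/

/-- The distribution of `n` independent samples of `p`, drawn one after the other. -/
def iid {α : Type*} (p : PMF α) : (n : ℕ) → PMF (Fin n → α)
  | 0 => PMF.pure Fin.elim0
  | n + 1 => p.bind fun a => (iid p n).map (Fin.cons a)

lemma iid_apply {α : Type*} (p : PMF α) (n : ℕ) (x : Fin n → α) : iid p n x = ∏ i, p (x i) := by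
  classical
  induction n with
  | zero => simp [iid, PMF.pure_apply, Subsingleton.elim x Fin.elim0]
  | succ n ih =>
    have hmap : ∀ a, (iid p n).map (Fin.cons a) x
        = if a = x 0 then iid p n (Fin.tail x) else 0 := by
      intro a
      rw [PMF.map_apply]
      have hiff : ∀ y : Fin n → α, (x = Fin.cons a y) ↔ (a = x 0 ∧ y = Fin.tail x) := by
        intro y
        constructor
        · rintro rfl
          simp
        · rintro ⟨rfl, rfl⟩
          simp
      by_cases h : a = x 0
      · rw [if_pos h, tsum_eq_single (Fin.tail x)]
        · rw [if_pos ((hiff _).2 ⟨h, rfl⟩)]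
        · intro y hy
          rw [if_neg fun hh => hy ((hiff y).1 hh).2]
      · rw [if_neg h]
        exact ENNReal.tsum_eq_zero.2 fun y => if_neg fun hh => h ((hiff y).1 hh).1
    rw [iid, PMF.bind_apply, tsum_eq_single (x 0)]
    · rw [hmap, if_pos rfl, ih, Fin.prod_univ_succ]
      rfl
    · intro a ha
      rw [hmap, if_neg ha, mul_zero]

/-- The arguments of the prepare-and-measure protocol that describe a single round up to raw key
generation. The cq-state `ψ_UQ = ∑ᵤ p(u) |u⟩⟨u| ⊗ ψ_{Q|u}` is given by `p` and the states
`ψ_{Q|u}`. -/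
structure Protocol (H U V I S : Type*) [NormedAddCommGroup H] [InnerProductSpace ℂ H]
    [CompleteSpace H] [Fintype V] where
  /-- the distribution of the classical label kept by Alice -/
  p : PMF U
  /-- the state sent by Alice for each label -/
  ψ : U → State H
  /-- the measurement performed by Bob -/
  N : POVM H V
  /-- the public discussion -/
  pd : U → V → I
  /-- the raw key generation -/
  rk : U → I → S

/-- A one-way error-correction protocol for `n` rounds with a `lam`-bit message: Alice sends
`enc Sⁿ`, and Bob computes his guess from this message, `Vⁿ` and `Iⁿ`. -/
structure ErrorCorrection (S V I : Type*) (n lam : ℕ) where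
  enc : (Fin n → S) → (Fin lam → Bool)
  dec : (Fin lam → Bool) → (Fin n → V) → (Fin n → I) → (Fin n → S)

/-- A universal hash family, given as a distribution on functions to `l`-bit strings. -/
def IsUniversalHash {M : Type*} {l : ℕ} (F : PMF (M → (Fin l → Bool))) : Prop :=
  ∀ x x' : M, x ≠ x' → F.toOuterMeasure {f | f x = f x'} ≤ (2⁻¹ : ℝ≥0∞) ^ l

namespace Protocol

variable {H U V I S : Type*} [NormedAddCommGroup H] [InnerProductSpace ℂ H] [CompleteSpace H]
  [Fintype V] (P : Protocol H U V I S) (noise : Channel H)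

/-- The joint distribution of `(U, V)` in one honest round, where the channel from Alice to Bob is
given by the noise model. -/
def honestUV : PMF (U × V) :=
  P.p.bind fun u => (P.N.outcome (noise.apply (P.ψ u))).map fun v => (u, v)

/-- The public transcript `I = pd(U, V)` of a round. -/
def transcript (x : U × V) : I := P.pd x.1 x.2

/-- The raw key symbol `S = rk(U, I)` of a round. -/
def rawKey (x : U × V) : S := P.rk x.1 (P.transcript x)

/-- The marginal on `S`, `V`, `I` of the honest single-round state. -/
def honestSVI [DecidableEq S] [DecidableEq V] [DecidableEq I] :
    Matrix (S × (V × I)) (S × (V × I)) ℂ :=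
  classicalState ((P.honestUV noise).map fun x => (P.rawKey x, (x.2, P.transcript x)))

variable {n lam : ℕ}

/-- The raw key `Sⁿ` held by Alice. -/
def aliceKey (x : Fin n → U × V) : Fin n → S := fun i => P.rawKey (x i)

/-- The guess `Ŝⁿ` of Bob for the raw key, after error correction. -/
def bobKey (code : ErrorCorrection S V I n lam) (x : Fin n → U × V) : Fin n → S :=
  code.dec (code.enc (P.aliceKey x)) (fun i => (x i).2) (fun i => P.transcript (x i))

/-- The probability that `Sⁿ ≠ Ŝⁿ` in the honest implementation with `n` rounds. -/
def errorProb (code : ErrorCorrection S V I n lam) : ℝ≥0∞ :=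
  (iid (P.honestUV noise) n).toOuterMeasure {x | P.aliceKey x ≠ P.bobKey code x}

/-- The probability that raw key validation, with a hash function drawn from `F` independently of
the data, aborts in the honest implementation with `n` rounds. -/
def validationAbortProb (code : ErrorCorrection S V I n lam) {l : ℕ}
    (F : PMF ((Fin n → S) → (Fin l → Bool))) : ℝ≥0∞ :=
  ((iid (P.honestUV noise) n).bind fun x => F.map fun f => (x, f)).toOuterMeasure
    {y | y.2 (P.aliceKey y.1) ≠ y.2 (P.bobKey code y.1)}

end Protocol

end QKD

end

/-!
Only the classical law `q` of `(S, (V, I))` in one honest round matters: an honest run consists of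
`n` independent samples of it (`QKD.Protocol.errorProb_eq_sum`), and the conditional entropy of the
diagonal state is the Shannon conditional entropy of `q` (`QKD.condEntropy_classicalState`). The
claim is thus finite blocklength Slepian-Wolf coding.

The encoder is a random function, and the decoder looks for a sequence with the announced message
whose conditional probability is at least `τ = exp (-T)`. The error probability is at most the
probability that the true sequence has conditional probability below `τ`, plus the probability
`1 / (τ 2 ^ lam)` of a confusion (`exists_code_error_le`). With `L = ln (2 / ε)` and
`T = lam ln 2 - L` the second term is `ε / 2`.

The first term is a tail of the sum of `n` independent surprisals `-ln q(s|w)`, whose mean is the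
conditional entropy. It is bounded by the Chernoff method (`exists_chernoff_exponent`). For large
`n` the moment generating function is sub-Gaussian near the origin, with variance proxy of order
`ln² (1 + 2 |S|)` (`sum_mul_rpow_condProb_le`); for small `n` it suffices that the mean of
`1 / q(s|w)` is at most `|S|`.

Finally, key validation aborts only if the two keys differ, whatever the hash function is
(`QKD.Protocol.validationAbortProb_le_errorProb`).
-/

/-! ### Entropy of classical states -/

/-- A diagonal matrix and the diagonal matrix of its eigenvalues have the same characteristic
polynomial, so the diagonal entries are the eigenvalues up to order. -/
lemma trace_cfc_diagonal_ofReal {A : Type*} [Fintype A] [DecidableEq A] (f : ℝ → ℝ) (p : A → ℝ) :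
    (Matrix.trace (cfc f (Matrix.diagonal fun x => ((p x : ℝ) : ℂ)))).re = ∑ x, f (p x) := by
  have hA : (Matrix.diagonal fun x => ((p x : ℝ) : ℂ)).IsHermitian := by
    rw [Matrix.IsHermitian, Matrix.diagonal_conjTranspose]
    congr 1
    funext x
    simp
  have h1 := hA.charpoly_eq
  rw [Matrix.charpoly_diagonal] at h1
  have h2 := congrArg Polynomial.roots h1
  have hroots : ∀ g : A → ℝ, (∏ i, (Polynomial.X - Polynomial.C ((g i : ℝ) : ℂ))).roots
      = Finset.univ.val.map fun i => ((g i : ℝ) : ℂ) := by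
    intro g
    rw [Polynomial.roots_prod]
    · simp
    · simp [Finset.prod_ne_zero_iff, Polynomial.X_sub_C_ne_zero]
  have h3 := (hroots p).symm.trans (h2.trans (hroots hA.eigenvalues))
  have h4 := congrArg (fun s : Multiset ℂ => (s.map fun z => f z.re).sum) h3
  simp only [Multiset.map_map, Function.comp_def, Complex.ofReal_re] at h4
  have h5 : Matrix.trace (cfc f (Matrix.diagonal fun x => ((p x : ℝ) : ℂ)))
      = ((∑ i, f (hA.eigenvalues i) : ℝ) : ℂ) := by
    rw [hA.cfc_eq, Matrix.IsHermitian.cfc, Unitary.conjStarAlgAut_apply, Matrix.trace_mul_comm,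
      ← mul_assoc]
    simp [Matrix.trace_diagonal]
  rw [h5, Complex.ofReal_re]
  exact h4.symm

namespace QKD

lemma vonNeumannEntropy_classicalState {A : Type*} [Fintype A] [DecidableEq A] (p : PMF A) :
    vonNeumannEntropy (classicalState p)
      = (∑ x, Real.negMulLog (p x).toReal) / Real.log 2 := by
  rw [vonNeumannEntropy, classicalState, trace_cfc_diagonal_ofReal]

lemma marginalRight_classicalState {A B : Type*} [Fintype A] [DecidableEq A] [DecidableEq B]
    (q : PMF (A × B)) :
    marginalRight (classicalState q)
      = Matrix.diagonal fun b => ((∑ a, (q (a, b)).toReal : ℝ) : ℂ) := by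
  ext b b'
  by_cases h : b = b'
  · subst h
    simp [marginalRight, classicalState]
  · simp [marginalRight, classicalState, h]

/-- The conditional entropy of a classical state is `∑ q(a,b) ln (q(b) / q(a,b))`, converted to
base two. Terms with `q(a,b) = 0` vanish. -/
lemma condEntropy_classicalState {A B : Type*} [Fintype A] [DecidableEq A] [Fintype B]
    [DecidableEq B] (q : PMF (A × B)) :
    condEntropy (classicalState q) = (∑ a, ∑ b, (q (a, b)).toReal *
      -Real.log ((q (a, b)).toReal / ∑ a', (q (a', b)).toReal)) / Real.log 2 := by
  rw [condEntropy, vonNeumannEntropy_classicalState, marginalRight_classicalState,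
    vonNeumannEntropy, trace_cfc_diagonal_ofReal, ← sub_div, Fintype.sum_prod_type]
  congr 1
  have h : ∑ b, Real.negMulLog (∑ a, (q (a, b)).toReal)
      = ∑ a, ∑ b, (q (a, b)).toReal * -Real.log (∑ a', (q (a', b)).toReal) := by
    rw [Finset.sum_comm]
    refine Finset.sum_congr rfl fun b _ => ?_
    rw [← Finset.sum_mul, Real.negMulLog, neg_mul, mul_neg]
  rw [h, ← Finset.sum_sub_distrib]
  refine Finset.sum_congr rfl fun a _ => ?_
  rw [← Finset.sum_sub_distrib]
  refine Finset.sum_congr rfl fun b _ => ?_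
  rcases eq_or_ne (q (a, b)).toReal 0 with h0 | h0
  · simp [h0]
  · have hs : ∑ a', (q (a', b)).toReal ≠ 0 := by
      refine (lt_of_lt_of_le (lt_of_le_of_ne ENNReal.toReal_nonneg h0.symm) ?_).ne'
      exact Finset.single_le_sum (f := fun a' => (q (a', b)).toReal)
        (fun _ _ => ENNReal.toReal_nonneg) (Finset.mem_univ a)
    rw [Real.log_div h0 hs, Real.negMulLog]
    ring

end QKD

/-! ### Random binning -/

/-- A random function identifies two given distinct points with probability at most `1 / |C|`. -/
lemma card_apply_eq_apply_mul_card_le {A C : Type*} [Fintype A] [DecidableEq A] [Fintype C]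
    [DecidableEq C] {a a' : A} (h : a' ≠ a) :
    (Finset.univ.filter fun f : A → C => f a' = f a).card * Fintype.card C
      ≤ Fintype.card (A → C) := by
  rw [← Finset.card_univ (α := C), ← Finset.card_product, ← Finset.card_univ (α := A → C)]
  -- Overwriting the value at `a` loses nothing, since it can be read off at `a'`.
  refine Finset.card_le_card_of_injOn (fun y => Function.update y.1 a y.2)
    (fun _ _ => Finset.mem_coe.2 (Finset.mem_univ _)) ?_
  rintro ⟨f, c⟩ hf ⟨g, d⟩ hg hfg
  simp only [Finset.coe_product, Set.mem_prod, Finset.mem_coe, Finset.mem_filter,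
    Finset.mem_univ, true_and, and_true] at hf hg
  have key : ∀ x, Function.update f a c x = Function.update g a d x := congrFun hfg
  have hcd : c = d := by simpa using key a
  have hne : ∀ x, x ≠ a → f x = g x := fun x hx => by simpa [hx] using key x
  refine Prod.ext (funext fun x => ?_) hcd
  by_cases hx : x = a
  · rw [hx]
    exact hf.symm.trans ((hne a' h).trans hg)
  · exact hne x hx

/-- One-shot Slepian-Wolf coding: `a` is compressed to a message in `C` and recovered from this
message and the side information `b`. The decoder looks for an `a'` with the right message and
`Q a' b ≥ τ`; there are at most `1 / τ` candidates, so a random encoder confuses the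
true one with another with probability at most `1 / (τ |C|)`. The function `bad` is any nonnegative majorant
of the indicator of `Q a b < τ` on the support of `p`. -/
theorem exists_code_error_le {A B C : Type*} [Fintype A] [Nonempty A] [Fintype B]
    [Fintype C] [Nonempty C] (p Q : A → B → ℝ) (hp : ∀ a b, 0 ≤ p a b)
    (hp1 : ∑ a, ∑ b, p a b = 1) (hQ : ∀ a b, 0 ≤ Q a b) (hQ1 : ∀ b, ∑ a, Q a b ≤ 1)
    {τ : ℝ} (hτ : 0 < τ) (bad : A → B → ℝ) (hb0 : ∀ a b, 0 ≤ bad a b)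
    (hb1 : ∀ a b, 0 < p a b → Q a b < τ → 1 ≤ bad a b) :
    ∃ (enc : A → C) (dec : C → B → A),
      (open Classical in ∑ a, ∑ b, if a ≠ dec (enc a) b then p a b else 0)
        ≤ ∑ a, ∑ b, p a b * bad a b + 1 / (τ * Fintype.card C) := by
  classical
  set K : ℝ := (Fintype.card C : ℝ) with hK
  have hK0 : 0 < K := by rw [hK]; exact_mod_cast Fintype.card_pos
  set F : ℝ := (Fintype.card (A → C) : ℝ) with hF
  -- The expected number of false candidates.
  let coll : (A → C) → ℝ := fun f => ∑ a, ∑ b, p a b *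
    ∑ a', if a' ≠ a ∧ τ ≤ Q a' b ∧ f a' = f a then 1 else 0
  have havg : ∑ f, coll f ≤ ∑ _f : A → C, 1 / (τ * K) := by
    have hcand : ∀ b, ∑ a', (if τ ≤ Q a' b then (1 : ℝ) else 0) ≤ 1 / τ := by
      intro b
      rw [le_div_iff₀ hτ, Finset.sum_mul]
      refine le_trans (Finset.sum_le_sum fun a' _ => ?_) (hQ1 b)
      split_ifs with h
      · simpa using h
      · simpa using hQ a' b
    have hpair : ∀ a b a', ∑ f : A → C, (if a' ≠ a ∧ τ ≤ Q a' b ∧ f a' = f a then (1 : ℝ) else 0)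
        ≤ F / K * if τ ≤ Q a' b then (1 : ℝ) else 0 := by
      intro a b a'
      by_cases h1 : τ ≤ Q a' b
      · by_cases h2 : a' ≠ a
        · simp only [h1, h2, ne_eq, not_false_eq_true, true_and, if_true, mul_one]
          rw [Finset.sum_boole, le_div_iff₀ hK0]
          have := card_apply_eq_apply_mul_card_le (C := C) h2
          rw [hK, hF]
          exact_mod_cast this
        · simp only [h2, false_and, if_false, Finset.sum_const_zero]
          positivity
      · simp [h1]
    calc ∑ f, coll f
        = ∑ a, ∑ b, p a b * ∑ a', ∑ f : A → C,
            (if a' ≠ a ∧ τ ≤ Q a' b ∧ f a' = f a then (1 : ℝ) else 0) := by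
          rw [Finset.sum_comm]
          refine Finset.sum_congr rfl fun a _ => ?_
          rw [Finset.sum_comm]
          refine Finset.sum_congr rfl fun b _ => ?_
          rw [← Finset.mul_sum, Finset.sum_comm]
      _ ≤ ∑ a, ∑ b, p a b * (F / K * (1 / τ)) := by
          refine Finset.sum_le_sum fun a _ => Finset.sum_le_sum fun b _ =>
            mul_le_mul_of_nonneg_left ?_ (hp a b)
          refine (Finset.sum_le_sum fun a' _ => hpair a b a').trans ?_
          rw [← Finset.mul_sum]
          exact mul_le_mul_of_nonneg_left (hcand b) (by positivity)
      _ = ∑ _f : A → C, 1 / (τ * K) := by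
          simp_rw [← Finset.sum_mul]
          rw [hp1, Finset.sum_const, Finset.card_univ, nsmul_eq_mul, ← hF]
          field_simp
  obtain ⟨f, -, hf⟩ := Finset.exists_le_of_sum_le Finset.univ_nonempty havg
  let dec : C → B → A := fun c b =>
    if h : ∃ a', τ ≤ Q a' b ∧ f a' = c then h.choose else Classical.arbitrary A
  refine ⟨f, dec, ?_⟩
  refine le_trans ?_ (add_le_add_right hf _)
  rw [← Finset.sum_add_distrib]
  refine Finset.sum_le_sum fun a _ => ?_
  rw [← Finset.sum_add_distrib]
  refine Finset.sum_le_sum fun b _ => ?_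
  rw [← mul_add]
  have hn : 0 ≤ ∑ a', (if a' ≠ a ∧ τ ≤ Q a' b ∧ f a' = f a then (1 : ℝ) else 0) :=
    Finset.sum_nonneg fun _ _ => by positivity
  split_ifs with hne
  · rcases (hp a b).eq_or_lt with hp0 | hp0
    · simp [← hp0]
    refine le_mul_of_one_le_right (hp a b) ?_
    by_cases hlt : Q a b < τ
    · linarith [hb1 a b hp0 hlt]
    · have hex : ∃ a', τ ≤ Q a' b ∧ f a' = f a := ⟨a, not_lt.1 hlt, rfl⟩
      have hdec : dec (f a) b = hex.choose := dif_pos hex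
      rw [hdec] at hne
      have h1 : (1 : ℝ) ≤ ∑ a', (if a' ≠ a ∧ τ ≤ Q a' b ∧ f a' = f a then (1 : ℝ) else 0) := by
        refine le_trans ?_ (Finset.single_le_sum (fun _ _ => by positivity)
          (Finset.mem_univ hex.choose))
        rw [if_pos ⟨hne.symm, hex.choose_spec⟩]
      linarith [hb0 a b]
  · exact mul_nonneg (hp a b) (add_nonneg (hb0 a b) hn)

/-! ### Moment generating function of the conditional surprisal -/

lemma exp_le_one_add_add_sq_mul_exp {y : ℝ} (hy : 0 ≤ y) :
    Real.exp y ≤ 1 + y + y ^ 2 * Real.exp y := by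
  -- Multiply `1 - y ≤ exp (-y)` by `(1 + y) exp y`.
  have h1 : 1 - y ≤ Real.exp (-y) := by linarith [Real.add_one_le_exp (-y)]
  have h2 : (1 - y) * Real.exp y ≤ 1 := by
    have := mul_le_mul_of_nonneg_right h1 (Real.exp_pos y).le
    rwa [← Real.exp_add, neg_add_cancel, Real.exp_zero] at this
  nlinarith

lemma exp_one_div_six_le : Real.exp (1 / 6) ≤ 6 / 5 := by
  have h : Real.exp (1 / 6) ^ 6 ≤ (6 / 5 : ℝ) ^ 6 := by
    rw [← Real.exp_nat_mul]
    have := Real.exp_one_lt_d9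
    norm_num
    linarith
  exact le_of_pow_le_pow_left₀ (by norm_num) (by norm_num) h

/-- The left side is the second order term of the moment generating function. On the right,
`exp x` has a mean that does not grow faster than `exp m`, when `x` is a surprisal. -/
lemma sq_mul_exp_le {m x α : ℝ} (hm : 1 ≤ m) (hx : 0 ≤ x) (hα : α * m ≤ 1 / 6) :
    x ^ 2 * Real.exp (α * x) ≤ m ^ 2 * (6 / 5 + 13 / 5 * Real.exp (x - m)) := by
  have hm0 : 0 < m := by linarith
  obtain ⟨y, rfl⟩ : ∃ y, x = m * y := ⟨x / m, by field_simp⟩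
  have hy : 0 ≤ y := nonneg_of_mul_nonneg_right hx hm0
  rw [mul_pow, mul_assoc]
  refine mul_le_mul_of_nonneg_left ?_ (by positivity)
  have hexp : Real.exp (α * (m * y)) ≤ Real.exp (1 / 6 * y) := by
    rw [← mul_assoc]
    exact Real.exp_le_exp.2 (mul_le_mul_of_nonneg_right hα hy)
  refine (mul_le_mul_of_nonneg_left hexp (by positivity)).trans ?_
  rcases le_total y 1 with h | h
  · have h1 : Real.exp (1 / 6 * y) ≤ 6 / 5 :=
      (Real.exp_le_exp.2 (by linarith)).trans exp_one_div_six_le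
    have h2 : y ^ 2 ≤ 1 := pow_le_one₀ hy h
    have := mul_le_mul h2 h1 (Real.exp_pos _).le zero_le_one
    linarith [Real.exp_pos (m * y - m)]
  · -- `5 y / 12 ≤ exp (5 y / 12 - 1)` leaves the rate `1 / 6 + 5 / 6 = 1` in the exponent.
    have h1 : y ≤ 12 / 5 * Real.exp (5 / 12 * y - 1) := by
      linarith [Real.add_one_le_exp (5 / 12 * y - 1)]
    have h2 : y ^ 2 ≤ (12 / 5) ^ 2 * Real.exp (5 / 6 * y - 2) := by
      calc y ^ 2 ≤ (12 / 5 * Real.exp (5 / 12 * y - 1)) ^ 2 := pow_le_pow_left₀ hy h1 2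
        _ = _ := by
          rw [mul_pow, ← Real.exp_nat_mul]
          congr 2
          push_cast
          ring
    have h3 : Real.exp (5 / 6 * y - 2) * Real.exp (1 / 6 * y)
        = Real.exp (-1) * Real.exp (y - 1) := by
      rw [← Real.exp_add, ← Real.exp_add]
      congr 1
      ring
    have h4 : (12 / 5) ^ 2 * Real.exp (-1) ≤ 13 / 5 := by
      have := Real.exp_neg_one_lt_d9
      linarith
    have h5 : Real.exp (y - 1) ≤ Real.exp (m * y - m) := by
      refine Real.exp_le_exp.2 ?_
      nlinarith
    calc y ^ 2 * Real.exp (1 / 6 * y)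
        ≤ (12 / 5) ^ 2 * Real.exp (5 / 6 * y - 2) * Real.exp (1 / 6 * y) :=
          mul_le_mul_of_nonneg_right h2 (Real.exp_pos _).le
      _ = (12 / 5) ^ 2 * Real.exp (-1) * Real.exp (y - 1) := by rw [mul_assoc, h3, mul_assoc]
      _ ≤ 13 / 5 * Real.exp (m * y - m) := mul_le_mul h4 h5 (Real.exp_pos _).le (by norm_num)
      _ ≤ _ := by linarith

/-- The conditional probabilities `q(a|b)` of a joint weight function `q`; zero where
`q(b) = 0`. -/
noncomputable def condProb {A B : Type*} [Fintype A] (q : A → B → ℝ) (a : A) (b : B) : ℝ :=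
  q a b / ∑ a', q a' b

lemma condProb_nonneg {A B : Type*} [Fintype A] {q : A → B → ℝ} (hq : ∀ a b, 0 ≤ q a b)
    (a : A) (b : B) : 0 ≤ condProb q a b :=
  div_nonneg (hq a b) (Finset.sum_nonneg fun _ _ => hq _ b)

lemma condProb_le_one {A B : Type*} [Fintype A] {q : A → B → ℝ} (hq : ∀ a b, 0 ≤ q a b)
    (a : A) (b : B) : condProb q a b ≤ 1 :=
  div_le_one_of_le₀ (Finset.single_le_sum (f := fun a' => q a' b) (fun _ _ => hq _ b)
    (Finset.mem_univ a)) (Finset.sum_nonneg fun _ _ => hq _ b)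

lemma condProb_pos {A B : Type*} [Fintype A] {q : A → B → ℝ} (hq : ∀ a b, 0 ≤ q a b)
    {a : A} {b : B} (h : 0 < q a b) : 0 < condProb q a b :=
  div_pos h (h.trans_le (Finset.single_le_sum (f := fun a' => q a' b) (fun _ _ => hq _ b)
    (Finset.mem_univ a)))

lemma sum_condProb_le_one {A B : Type*} [Fintype A] (q : A → B → ℝ) (b : B) :
    ∑ a, condProb q a b ≤ 1 := by
  unfold condProb
  rw [← Finset.sum_div]
  exact div_self_le_one _

/-- Each pair with `q(a,b) > 0` contributes `q(b)` to the mean of `1 / q(a|b)`. -/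
lemma sum_mul_inv_condProb_le {A B : Type*} [Fintype A] [Fintype B] {q : A → B → ℝ}
    (hq : ∀ a b, 0 ≤ q a b) (hq1 : ∑ a, ∑ b, q a b = 1) :
    ∑ a, ∑ b, q a b * (condProb q a b)⁻¹ ≤ Fintype.card A := by
  calc ∑ a, ∑ b, q a b * (condProb q a b)⁻¹ ≤ ∑ _a : A, ∑ b, ∑ a', q a' b := by
        refine Finset.sum_le_sum fun a _ => Finset.sum_le_sum fun b _ => ?_
        rcases (hq a b).eq_or_lt with h | h
        · rw [← h, zero_mul]
          exact Finset.sum_nonneg fun _ _ => hq _ b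
        · rw [condProb, inv_div, mul_div_cancel₀ _ h.ne']
    _ = Fintype.card A := by
        rw [Finset.sum_const, Finset.sum_comm, hq1]
        simp

/-- The conditional entropy `H(A|B)`, in nats, of a joint weight function. -/
noncomputable def condEntropyNats {A B : Type*} [Fintype A] [Fintype B] (q : A → B → ℝ) : ℝ :=
  ∑ a, ∑ b, q a b * -Real.log (condProb q a b)

lemma condEntropyNats_nonneg {A B : Type*} [Fintype A] [Fintype B] {q : A → B → ℝ}
    (hq : ∀ a b, 0 ≤ q a b) : 0 ≤ condEntropyNats q :=
  Finset.sum_nonneg fun a _ => Finset.sum_nonneg fun b _ => mul_nonneg (hq a b)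
    (neg_nonneg.2 (Real.log_nonpos (condProb_nonneg hq a b) (condProb_le_one hq a b)))

/-- The moment generating function of the surprisal `-ln q(a|b)` is that of a sub-Gaussian
variable near the origin. The second order term is controlled by the mean of `1 / q(a|b)`,
which is at most `|A|`. -/
theorem sum_mul_rpow_condProb_le {A B : Type*} [Fintype A] [Fintype B] {q : A → B → ℝ}
    (hq : ∀ a b, 0 ≤ q a b) (hq1 : ∑ a, ∑ b, q a b = 1) {m α : ℝ} (hm : 1 ≤ m)
    (hmA : 1 + 2 * (Fintype.card A : ℝ) ≤ Real.exp m) (hα0 : 0 ≤ α) (hα : α * m ≤ 1 / 6) :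
    ∑ a, ∑ b, q a b * condProb q a b ^ (-α)
      ≤ Real.exp (α * condEntropyNats q + 5 / 2 * (α * m) ^ 2) := by
  have hterm : ∀ a b, q a b * condProb q a b ^ (-α)
      ≤ q a b * (1 + 6 / 5 * (α * m) ^ 2) + α * (q a b * -Real.log (condProb q a b))
        + 13 / 5 * (α * m) ^ 2 * Real.exp (-m) * (q a b * (condProb q a b)⁻¹) := by
    intro a b
    rcases (hq a b).eq_or_lt with h | h
    · simp [← h]
    have hk := condProb_pos hq h
    obtain ⟨x, hx⟩ : ∃ x, x = -Real.log (condProb q a b) := ⟨_, rfl⟩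
    have hx0 : 0 ≤ x := by
      rw [hx]
      exact neg_nonneg.2 (Real.log_nonpos hk.le (condProb_le_one hq a b))
    have e1 : condProb q a b ^ (-α) = Real.exp (α * x) := by
      rw [Real.rpow_def_of_pos hk, hx]
      ring_nf
    have e2 : (condProb q a b)⁻¹ = Real.exp x := by
      rw [hx, Real.exp_neg, Real.exp_log hk]
    have e3 : Real.exp (x - m) = Real.exp (-m) * Real.exp x := by
      rw [← Real.exp_add]
      ring_nf
    have h1 := exp_le_one_add_add_sq_mul_exp (mul_nonneg hα0 hx0)
    have h2 := mul_le_mul_of_nonneg_left (sq_mul_exp_le hm hx0 hα) (sq_nonneg α)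
    rw [e3] at h2
    rw [e1, e2, ← hx]
    have h3 : Real.exp (α * x) ≤ 1 + 6 / 5 * (α * m) ^ 2 + α * x
        + 13 / 5 * (α * m) ^ 2 * Real.exp (-m) * Real.exp x := by
      nlinarith
    have := mul_le_mul_of_nonneg_left h3 h.le
    linarith
  have hd : Real.exp (-m) * ∑ a, ∑ b, q a b * (condProb q a b)⁻¹ ≤ 1 / 2 := by
    have h1 := mul_le_mul_of_nonneg_left (sum_mul_inv_condProb_le hq hq1) (Real.exp_pos (-m)).le
    have h2 : Real.exp (-m) * (1 + 2 * (Fintype.card A : ℝ)) ≤ 1 := by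
      have := mul_le_mul_of_nonneg_left hmA (Real.exp_pos (-m)).le
      rwa [← Real.exp_add, neg_add_cancel, Real.exp_zero] at this
    have := Real.exp_pos (-m)
    linarith
  have hsum : ∑ a, ∑ b, q a b * condProb q a b ^ (-α)
      ≤ (1 + 6 / 5 * (α * m) ^ 2) + α * condEntropyNats q
        + 13 / 5 * (α * m) ^ 2 * Real.exp (-m) * ∑ a, ∑ b, q a b * (condProb q a b)⁻¹ := by
    refine (Finset.sum_le_sum fun a _ => Finset.sum_le_sum fun b _ => hterm a b).trans_eq ?_
    simp only [Finset.sum_add_distrib, ← Finset.mul_sum, ← Finset.sum_mul, hq1, one_mul,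
      condEntropyNats]
  refine hsum.trans (le_trans ?_ (Real.add_one_le_exp _))
  nlinarith [mul_le_mul_of_nonneg_left hd (sq_nonneg (α * m))]

/-! ### Fixed-length compression of independent samples -/

lemma sum_sum_prod_eq_pow {A B : Type*} [Fintype A] [Fintype B] (g : A → B → ℝ) (n : ℕ) :
    ∑ s : Fin n → A, ∑ w : Fin n → B, ∏ i, g (s i) (w i) = (∑ a, ∑ b, g a b) ^ n := by
  classical
  have h : ∀ s : Fin n → A, ∑ w : Fin n → B, ∏ i, g (s i) (w i) = ∏ i, ∑ b, g (s i) b := by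
    intro s
    rw [Finset.prod_univ_sum, Fintype.piFinset_univ]
  simp_rw [h]
  rw [Finset.sum_pow', Fintype.piFinset_univ]

/-- The Chernoff exponent: some `α` makes the tail bound `exp (-α T) (𝔼 q(a|b)^(-α))ⁿ` at most
`exp (-L)`. For `√n ≤ 2 r` the choice `α = 1` works, since `T` then exceeds `n ln |A| + L`;
otherwise `α = r / (3 √n m)`, which lies in the range where the moment generating function
is sub-Gaussian. -/
lemma exists_chernoff_exponent {A B : Type*} [Fintype A] [Nonempty A] [Fintype B]
    {q : A → B → ℝ} (hq : ∀ a b, 0 ≤ q a b) (hq1 : ∑ a, ∑ b, q a b = 1) {n : ℕ} {r L T : ℝ}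
    (hr : 1 ≤ r) (hL : 0 ≤ L) (hrL : 18 / 7 * L ≤ r ^ 2)
    (hT : n * condEntropyNats q + 2 * √(n : ℝ) * r * Real.log (1 + 2 * (Fintype.card A : ℝ)) + L
      ≤ T) :
    ∃ α : ℝ, 0 < α ∧ Real.exp (-(α * T)) * (∑ a, ∑ b, q a b * condProb q a b ^ (-α)) ^ n
      ≤ Real.exp (-L) := by
  obtain ⟨m, hmdef⟩ : ∃ m, m = Real.log (1 + 2 * (Fintype.card A : ℝ)) := ⟨_, rfl⟩
  rw [← hmdef] at hT
  have hd1 : (1 : ℝ) ≤ Fintype.card A := by exact_mod_cast Fintype.card_pos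
  have hem : Real.exp m = 1 + 2 * (Fintype.card A : ℝ) := by
    rw [hmdef, Real.exp_log (by linarith)]
  have hm : 1 ≤ m := by
    rw [hmdef, Real.le_log_iff_exp_le (by linarith)]
    linarith [Real.exp_one_lt_d9]
  have hH := condEntropyNats_nonneg hq
  have hsum0 : ∀ α : ℝ, 0 ≤ ∑ a, ∑ b, q a b * condProb q a b ^ (-α) := fun α =>
    Finset.sum_nonneg fun a _ => Finset.sum_nonneg fun b _ => mul_nonneg (hq a b)
      (Real.rpow_nonneg (condProb_nonneg hq a b) _)
  have hsq : √(n : ℝ) * √(n : ℝ) = n := Real.mul_self_sqrt (Nat.cast_nonneg n)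
  have hs0 : 0 ≤ √(n : ℝ) := Real.sqrt_nonneg _
  rcases le_or_gt (√(n : ℝ)) (2 * r) with hn | hn
  · refine ⟨1, one_pos, ?_⟩
    have h1 : ∑ a, ∑ b, q a b * condProb q a b ^ (-(1 : ℝ)) ≤ Real.exp m := by
      simp only [Real.rpow_neg_one]
      rw [hem]
      linarith [sum_mul_inv_condProb_le hq hq1]
    refine (mul_le_mul_of_nonneg_left (pow_le_pow_left₀ (hsum0 1) h1 n) (Real.exp_pos _).le).trans ?_
    rw [← Real.exp_nat_mul, ← Real.exp_add, Real.exp_le_exp]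
    have h2 : (n : ℝ) * m ≤ 2 * √(n : ℝ) * r * m := by
      refine mul_le_mul_of_nonneg_right ?_ (by linarith)
      nlinarith
    have h3 : 0 ≤ (n : ℝ) * condEntropyNats q := by positivity
    linarith
  · have hs : 0 < √(n : ℝ) := by linarith
    obtain ⟨α, hα⟩ : ∃ α, α = r / (3 * √(n : ℝ) * m) := ⟨_, rfl⟩
    have hα0 : 0 < α := by rw [hα]; positivity
    have hαs : α * m * √(n : ℝ) = r / 3 := by rw [hα]; field_simp
    have hαm : α * m ≤ 1 / 6 := by
      by_contra! hcon
      nlinarith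
    refine ⟨α, hα0, ?_⟩
    have h1 := sum_mul_rpow_condProb_le hq hq1 hm hem.ge hα0.le hαm
    refine (mul_le_mul_of_nonneg_left (pow_le_pow_left₀ (hsum0 α) h1 n) (Real.exp_pos _).le).trans ?_
    rw [← Real.exp_nat_mul, ← Real.exp_add, Real.exp_le_exp]
    have h2 : (n : ℝ) * (α * m) ^ 2 = r ^ 2 / 9 := by
      rw [← hsq]
      calc √(n : ℝ) * √(n : ℝ) * (α * m) ^ 2 = (α * m * √(n : ℝ)) ^ 2 := by ring
        _ = r ^ 2 / 9 := by rw [hαs]; ring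
    have h3 := mul_le_mul_of_nonneg_left hT hα0.le
    have h4 : α * (2 * √(n : ℝ) * r * m) = 2 / 3 * r ^ 2 := by
      calc α * (2 * √(n : ℝ) * r * m) = 2 * r * (α * m * √(n : ℝ)) := by ring
        _ = _ := by rw [hαs]; ring
    have h5 : 0 ≤ α * L := by positivity
    -- The exponent is `(5 / 18 - 2 / 3) r ^ 2 = -(7 / 18) r ^ 2`.
    linarith

/-- Slepian-Wolf coding of `n` independent samples into `lam` bits, with error `ε`. -/
theorem exists_iid_code_error_le {A B : Type*} [Fintype A] [Nonempty A] [Fintype B]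
    {q : A → B → ℝ} (hq : ∀ a b, 0 ≤ q a b) (hq1 : ∑ a, ∑ b, q a b = 1) {n lam : ℕ} {ε : ℝ}
    (hε : 0 < ε) (hε1 : ε ≤ 1)
    (hlam : n * (condEntropyNats q / Real.log 2)
        + 2 * √(n : ℝ) * √(1 - 2 * Real.logb 2 (ε / 2)) * Real.logb 2 (1 + 2 * (Fintype.card A : ℝ))
        + 2 * Real.logb 2 (2 / ε) ≤ lam) :
    ∃ (enc : (Fin n → A) → (Fin lam → Bool)) (dec : (Fin lam → Bool) → (Fin n → B) → (Fin n → A)),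
      (open Classical in ∑ s, ∑ w, if s ≠ dec (enc s) w then ∏ i, q (s i) (w i) else 0) ≤ ε := by
  have hlog2 : 0 < Real.log 2 := Real.log_pos one_lt_two
  obtain ⟨L, hLdef⟩ : ∃ L, L = Real.log (2 / ε) := ⟨_, rfl⟩
  have hL : 0 ≤ L := by
    rw [hLdef]
    exact Real.log_nonneg (by rw [le_div_iff₀ hε]; linarith)
  have hexpL : Real.exp (-L) = ε / 2 := by
    rw [hLdef, Real.exp_neg, Real.exp_log (by positivity), inv_div]
  have hlogε : Real.log (ε / 2) = -L := by rw [← hexpL, Real.log_exp]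
  obtain ⟨r, hrdef⟩ : ∃ r, r = √(1 - 2 * Real.logb 2 (ε / 2)) := ⟨_, rfl⟩
  have hrarg : 1 - 2 * Real.logb 2 (ε / 2) = 1 + 2 * (L / Real.log 2) := by
    rw [Real.logb, hlogε]
    ring
  have hLdiv : L ≤ 7 / 9 * (L / Real.log 2) := by
    rw [← mul_div_assoc, le_div_iff₀ hlog2]
    nlinarith [Real.log_two_lt_d9]
  have hr2 : r ^ 2 = 1 + 2 * (L / Real.log 2) := by
    rw [hrdef, hrarg, Real.sq_sqrt (by positivity)]
  have hr : 1 ≤ r := by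
    rw [hrdef, hrarg, Real.one_le_sqrt]
    have : 0 ≤ L / Real.log 2 := by positivity
    linarith
  -- The threshold `T` for the surprisal leaves `L` nats of the message for the collision term.
  obtain ⟨T, hT⟩ : ∃ T, T = lam * Real.log 2 - L := ⟨_, rfl⟩
  have hTle : n * condEntropyNats q
      + 2 * √(n : ℝ) * r * Real.log (1 + 2 * (Fintype.card A : ℝ)) + L ≤ T := by
    have h := mul_le_mul_of_nonneg_right hlam hlog2.le
    rw [← hrdef, Real.logb, Real.logb, ← hLdef] at h
    have e : (n * (condEntropyNats q / Real.log 2)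
        + 2 * √(n : ℝ) * r * (Real.log (1 + 2 * (Fintype.card A : ℝ)) / Real.log 2)
        + 2 * (L / Real.log 2)) * Real.log 2
        = n * condEntropyNats q + 2 * √(n : ℝ) * r * Real.log (1 + 2 * (Fintype.card A : ℝ))
          + 2 * L := by
      field_simp
    rw [e] at h
    linarith
  obtain ⟨α, hα, hch⟩ := exists_chernoff_exponent hq hq1 hr hL (by linarith) hTle
  have hk0 : ∀ (s : Fin n → A) (w : Fin n → B), ∀ i, 0 ≤ condProb q (s i) (w i) :=
    fun s w i => condProb_nonneg hq _ _
  have hQ1 : ∀ w : Fin n → B, ∑ s : Fin n → A, ∏ i, condProb q (s i) (w i) ≤ 1 := by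
    intro w
    have : ∑ s : Fin n → A, ∏ i, condProb q (s i) (w i) = ∏ i, ∑ a, condProb q a (w i) := by
      classical rw [Finset.prod_univ_sum, Fintype.piFinset_univ]
    rw [this]
    exact Finset.prod_le_one (fun i _ => Finset.sum_nonneg fun a _ => condProb_nonneg hq _ _)
      (fun i _ => sum_condProb_le_one q _)
  have hbad0 : ∀ (s : Fin n → A) (w : Fin n → B),
      0 ≤ Real.exp (-(α * T)) * ∏ i, condProb q (s i) (w i) ^ (-α) := fun s w =>
    mul_nonneg (Real.exp_pos _).le (Finset.prod_nonneg fun i _ => Real.rpow_nonneg (hk0 s w i) _)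
  have hbad1 : ∀ (s : Fin n → A) (w : Fin n → B), 0 < ∏ i, q (s i) (w i) →
      ∏ i, condProb q (s i) (w i) < Real.exp (-T) →
      1 ≤ Real.exp (-(α * T)) * ∏ i, condProb q (s i) (w i) ^ (-α) := by
    intro s w hpos hlt
    have hk : ∀ i, 0 < condProb q (s i) (w i) := fun i =>
      condProb_pos hq ((hq _ _).lt_of_ne' (Finset.prod_ne_zero_iff.1 hpos.ne' i
        (Finset.mem_univ i)))
    have hP : 0 < ∏ i, condProb q (s i) (w i) := Finset.prod_pos fun i _ => hk i
    rw [Real.finsetProd_rpow _ _ (fun i _ => (hk i).le), Real.rpow_def_of_pos hP,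
      ← Real.exp_add, Real.one_le_exp_iff]
    have := (Real.log_lt_iff_lt_exp hP).2 hlt
    nlinarith
  have hp1 : ∑ s : Fin n → A, ∑ w : Fin n → B, ∏ i, q (s i) (w i) = 1 := by
    rw [sum_sum_prod_eq_pow, hq1, one_pow]
  obtain ⟨enc, dec, h⟩ := exists_code_error_le (C := Fin lam → Bool)
    (fun (s : Fin n → A) (w : Fin n → B) => ∏ i, q (s i) (w i))
    (fun s w => ∏ i, condProb q (s i) (w i))
    (fun s w => Finset.prod_nonneg fun i _ => hq _ _) hp1
    (fun s w => Finset.prod_nonneg fun i _ => hk0 s w i) hQ1 (Real.exp_pos (-T))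
    (fun s w => Real.exp (-(α * T)) * ∏ i, condProb q (s i) (w i) ^ (-α)) hbad0 hbad1
  refine ⟨enc, dec, le_trans (le_of_eq ?_) (h.trans ?_)⟩
  · refine Finset.sum_congr rfl fun s _ => Finset.sum_congr rfl fun w _ => ?_
    -- The two sides differ only in the instance deciding equality on `Fin n → A`.
    congr 1
  have h1 : ∑ s : Fin n → A, ∑ w : Fin n → B, (∏ i, q (s i) (w i))
        * (Real.exp (-(α * T)) * ∏ i, condProb q (s i) (w i) ^ (-α))
      = Real.exp (-(α * T)) * (∑ a, ∑ b, q a b * condProb q a b ^ (-α)) ^ n := by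
    rw [← sum_sum_prod_eq_pow]
    simp_rw [Finset.mul_sum, Finset.prod_mul_distrib]
    exact Finset.sum_congr rfl fun s _ => Finset.sum_congr rfl fun w _ => by ring
  have h2 : 1 / (Real.exp (-T) * (Fintype.card (Fin lam → Bool) : ℝ)) = ε / 2 := by
    have : (Fintype.card (Fin lam → Bool) : ℝ) = Real.exp (lam * Real.log 2) := by
      rw [Real.exp_nat_mul, Real.exp_log two_pos]
      simp
    rw [this, ← Real.exp_add, hT, ← hexpL, one_div, ← Real.exp_neg]
    ring_nf
  rw [h1, h2]
  rw [hexpL] at hch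
  linarith

/-! ### Honest executions of the protocol -/

namespace QKD

lemma iid_map {α β : Type*} (f : α → β) (p : PMF α) (n : ℕ) :
    (iid p n).map (fun x i => f (x i)) = iid (p.map f) n := by
  induction n with
  | zero =>
    rw [iid, iid, PMF.pure_map]
    congr 1
    exact Subsingleton.elim _ _
  | succ n ih =>
    rw [iid, iid, PMF.map_bind, PMF.bind_map]
    congr 1
    funext a
    rw [Function.comp_apply, ← ih, PMF.map_comp, PMF.map_comp]
    congr 1
    funext x i
    refine Fin.cases ?_ (fun j => ?_) i <;> simp

namespace Protocol

variable {H U V I S : Type*} [NormedAddCommGroup H] [InnerProductSpace ℂ H] [CompleteSpace H]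
  [Fintype V] (P : Protocol H U V I S) (noise : Channel H)

/-- The joint distribution of the raw key symbol `S` and of the data `(V, I)` available to Bob in
one honest round. -/
noncomputable def honestLaw : PMF (S × (V × I)) :=
  (P.honestUV noise).map fun x => (P.rawKey x, (x.2, P.transcript x))

open Classical in
/-- The error probability only depends on the law of `S`, `V` and `I`, so the system `Q` and the
label `U` drop out. -/
lemma errorProb_eq_sum [Fintype S] [Fintype I] {n lam : ℕ} (code : ErrorCorrection S V I n lam) :
    P.errorProb noise code = ENNReal.ofReal (∑ s : Fin n → S, ∑ w : Fin n → V × I,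
      if s ≠ code.dec (code.enc s) (fun i => (w i).1) (fun i => (w i).2)
        then ∏ i, (P.honestLaw noise (s i, w i)).toReal else 0) := by
  have h1 : P.errorProb noise code = (iid (P.honestLaw noise) n).toOuterMeasure
      {y | (fun i => (y i).1) ≠ code.dec (code.enc fun i => (y i).1) (fun i => (y i).2.1)
        (fun i => (y i).2.2)} := by
    rw [honestLaw, ← iid_map, PMF.toOuterMeasure_map_apply]
    rfl
  rw [h1, PMF.toOuterMeasure_apply, tsum_fintype,
    ← (Equiv.arrowProdEquivProdArrow (Fin n) (fun _ => S) (fun _ => V × I)).symm.sum_comp,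
    Fintype.sum_prod_type, ENNReal.ofReal_sum_of_nonneg]
  · refine Finset.sum_congr rfl fun s _ => ?_
    rw [ENNReal.ofReal_sum_of_nonneg]
    · refine Finset.sum_congr rfl fun w _ => ?_
      rw [Set.indicator_apply, iid_apply]
      simp only [Set.mem_ofPred_eq, Equiv.arrowProdEquivProdArrow_symm_apply]
      split_ifs with h
      · rw [ENNReal.ofReal_prod_of_nonneg fun _ _ => ENNReal.toReal_nonneg]
        exact Finset.prod_congr rfl fun i _ => (ENNReal.ofReal_toReal (PMF.apply_ne_top _ _)).symm
      · exact ENNReal.ofReal_zero.symm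
    · intro w _
      split_ifs
      · exact Finset.prod_nonneg fun _ _ => ENNReal.toReal_nonneg
      · exact le_rfl
  · intro s _
    refine Finset.sum_nonneg fun w _ => ?_
    split_ifs
    · exact Finset.prod_nonneg fun _ _ => ENNReal.toReal_nonneg
    · exact le_rfl

/-- Equal keys have equal hashes, so an abort requires a decoding error. -/
lemma validationAbortProb_le_errorProb {n lam l : ℕ} (code : ErrorCorrection S V I n lam)
    (F : PMF ((Fin n → S) → (Fin l → Bool))) :
    P.validationAbortProb noise code F ≤ P.errorProb noise code := by
  have h : P.errorProb noise code = ((iid (P.honestUV noise) n).bind fun x =>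
      F.map fun f => (x, f)).toOuterMeasure {y | P.aliceKey y.1 ≠ P.bobKey code y.1} := by
    have hfst : ((iid (P.honestUV noise) n).bind fun x => F.map fun f => (x, f)).map Prod.fst
        = iid (P.honestUV noise) n := by
      rw [PMF.map_bind]
      simp only [PMF.map_comp]
      have : ∀ x : Fin n → U × V, F.map (Prod.fst ∘ fun f => (x, f)) = PMF.pure x := fun x =>
        PMF.map_const F x
      simp only [this, PMF.bind_pure]
    rw [errorProb]
    conv_lhs => rw [← hfst]
    rw [PMF.toOuterMeasure_map_apply]
    rfl
  rw [h, validationAbortProb]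
  refine MeasureTheory.measure_mono fun y hy heq => hy ?_
  rw [heq]

end Protocol

end QKD

theorem mainTheorem5 {H U V I S : Type*} [NormedAddCommGroup H] [InnerProductSpace ℂ H]
    [CompleteSpace H] [Fintype V] [DecidableEq V] [Fintype I] [DecidableEq I]
    [Fintype S] [DecidableEq S]
    (P : QKD.Protocol H U V I S) (noise : QKD.Channel H) (n lam : ℕ)
    (ε : ℝ) (hε : 0 < ε) (hε1 : ε ≤ 1)
    (hlam : (n : ℝ) * QKD.condEntropy (P.honestSVI noise)
        + 2 * √(n : ℝ) * √(1 - 2 * Real.logb 2 (ε / 2)) * Real.logb 2 (1 + 2 * (Fintype.card S : ℝ))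
        + 2 * Real.logb 2 (2 / ε) ≤ (lam : ℝ)) :
    ∃ code : QKD.ErrorCorrection S V I n lam,
      P.errorProb noise code ≤ ENNReal.ofReal ε ∧
      ∀ εkv : ℝ, 0 < εkv →
        ∀ F : PMF ((Fin n → S) → (Fin ⌈Real.logb 2 (1 / εkv)⌉₊ → Bool)),
          QKD.IsUniversalHash F → P.validationAbortProb noise code F ≤ ENNReal.ofReal ε := by
  obtain ⟨⟨s₀, -⟩, -⟩ := (P.honestLaw noise).support_nonempty
  have : Nonempty S := ⟨s₀⟩
  have hq1 : ∑ s, ∑ w, (P.honestLaw noise (s, w)).toReal = 1 := by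
    rw [← Fintype.sum_prod_type' (f := fun s w => (P.honestLaw noise (s, w)).toReal),
      ← ENNReal.toReal_sum (fun _ _ => PMF.apply_ne_top _ _), ← tsum_fintype (L := .unconditional _),
      PMF.tsum_coe, ENNReal.toReal_one]
  have hent : QKD.condEntropy (P.honestSVI noise)
      = condEntropyNats (fun s w => (P.honestLaw noise (s, w)).toReal) / Real.log 2 :=
    QKD.condEntropy_classicalState (P.honestLaw noise)
  rw [hent] at hlam
  obtain ⟨enc, dec, h⟩ :=
    exists_iid_code_error_le (fun _ _ => ENNReal.toReal_nonneg) hq1 hε hε1 hlam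
  have herr : P.errorProb noise ⟨enc, fun c v i => dec c fun j => (v j, i j)⟩
      ≤ ENNReal.ofReal ε := by
    rw [P.errorProb_eq_sum]
    exact ENNReal.ofReal_le_ofReal h
  exact ⟨_, herr, fun _ _ F _ => (P.validationAbortProb_le_errorProb noise _ F).trans herr⟩
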